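/- Write $\hat{\mathbb R}=\mathbb R\cup\{\infty\}$. A rational function $h\in\mathbb R(z)$ is called weakly injective on $\mathbb R$ if there is $z_0\in\mathbb R$ which is not a critical point of $h$ (as a map of the projective line; so at a pole of $h$ the condition is that the pole is simple) and such that there is no $y_0\in\hat{\mathbb R}$ with $y_0\neq z_0$ and $h(y_0)=h(z_0)$. Theorem. Let $f,g\in\mathbb C(z)$ be non-constant rational functions such that $h(z)=f(g(z))$ lies in $\mathbb R(z)$ and is weakly injective on $\mathbb R$. Then there is a linear fractional function $\lambda(z)=\frac{az+b}{cz+d}\in\mathbb C(z)$, $ad-bc\neq 0$, such that $\lambda\circ g\in\mathbb R(z)$. -/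

import Mathlib

noncomputable section

namespace RationalMap

/-- The rational function `f ∈ K(z)` as a self-map of the projective line `K ∪ {∞}`.
At `∞` it takes the value `lim f(x)` for `x → ∞`, computed from the reduced fraction
`num f / denom f`, whose denominator is monic. -/
def proj {K : Type*} [Field K] (f : RatFunc K) : OnePoint K → OnePoint K
  | OnePoint.some x =>
      open Classical in
      if f.denom.eval x = 0 then OnePoint.infty
      else OnePoint.some (f.num.eval x / f.denom.eval x)
  | OnePoint.infty =>
      if f.denom.natDegree < f.num.natDegree then OnePoint.infty
      else OnePoint.some (f.num.coeff f.denom.natDegree)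

/-- `f` is a constant rational function. -/
def IsConst {K : Type*} [Field K] (f : RatFunc K) : Prop :=
  ∃ c : K, f = RatFunc.C c

/-- The composition `f ∘ g = f(g(z))` for non-constant `g`: substitute `g` for the variable
in the numerator and the denominator of `f` and divide in `K(z)`. -/
def comp {K : Type*} [Field K] (f g : RatFunc K) : RatFunc K :=
  f.eval RatFunc.C g

/-- The inclusion `ℝ(z) ⊆ ℂ(z)`. -/
def toComplex (h : RatFunc ℝ) : RatFunc ℂ :=
  h.eval (RatFunc.C.comp (algebraMap ℝ ℂ)) RatFunc.X

/-- `f ∈ ℂ(z)` lies in `ℝ(z)`. -/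
def IsReal (f : RatFunc ℂ) : Prop :=
  ∃ h : RatFunc ℝ, toComplex h = f

/-- The linear fractional functions `(az + b)/(cz + d)` with `ad - bc ≠ 0`. -/
def IsLinearFractional {K : Type*} [Field K] (l : RatFunc K) : Prop :=
  ∃ a b c d : K, a * d - b * c ≠ 0 ∧
    l = (RatFunc.C a * RatFunc.X + RatFunc.C b) / (RatFunc.C c * RatFunc.X + RatFunc.C d)

/-- `x ∈ ℝ` is a critical point of `h ∈ ℝ(z)`, as a map of the projective line: the derivative
of `h` vanishes at `x`, where at a pole of `h` the local coordinate `1/w` is used in the target,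
so that `h` is replaced by `1/h`. -/
def IsCriticalPoint (h : RatFunc ℝ) (x : ℝ) : Prop :=
  (h.denom.eval x ≠ 0 ∧ deriv (fun t : ℝ => h.eval (RingHom.id ℝ) t) x = 0) ∨
  (h.denom.eval x = 0 ∧ deriv (fun t : ℝ => h⁻¹.eval (RingHom.id ℝ) t) x = 0)

/-- `h ∈ ℝ(z)` is weakly injective on `ℝ`. -/
def WeaklyInjective (h : RatFunc ℝ) : Prop :=
  ∃ z₀ : ℝ, ¬ IsCriticalPoint h z₀ ∧
    ∀ y₀ : OnePoint ℝ, proj h y₀ = proj h (OnePoint.some z₀) → y₀ = OnePoint.some z₀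

end RationalMap

end

/-!
Write `ḡ` for `g` with complex conjugated coefficients. The claim follows once `ḡ ∈ ℂ(g)`: then
`ℂ(g)` is stable under conjugation, Lüroth's theorem gives `ℂ(g) ∩ ℝ(z) = ℝ(s)`, splitting into
real and imaginary parts gives `ℂ(g) = ℂ(s)`, and two generators of the same field differ by a
linear fractional function (`exists_isReal_comp`).

To see `ḡ ∈ ℂ(g)`, let `z₀` witness the weak injectivity of `h`. Every real `x` near `z₀` is then
the only real point in its fibre under `h` (`WeaklyInjective.exists_eventually`, a compactness
argument on the projective line). Take an ultrafilter on `ℝ` converging to `z₀` from the punctured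
neighbourhood. The germs of complex functions along it form an algebraically closed field with an
involution `τ`, complex conjugation; the germ `ω` of the identity is `τ`-fixed and transcendental
over `ℂ`, and it is the only `τ`-fixed solution of `h(β) = h(ω)`.

Let `u` be an automorphism of the algebraic closure of `ℂ(h(ω))` which fixes `ℂ(g(ω))`. The
involutions `τ` and `u τ u⁻¹` act on the finite fibre of `h` through `ω`, with the single fixed
points `ω` and `u ω`. Their dihedral group has both points in one orbit, of odd size, so that some
power `d` of `τ u τ u⁻¹` maps `ω` to `u ω` (`exists_mul_conj_pow_smul_eq`). Moreover `d` is
`ℂ`-linear and `τ d τ = d⁻¹`. Thus `d` agrees with `u` on `ℂ(ω)` and fixes `g(ω)`, whence it fixes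
`τ (g(ω)) = ḡ(ω)`, and so does `u`. By Galois theory `ḡ(ω) ∈ ℂ(g(ω))` (`conj_mem_adjoin`).
-/

namespace RationalMap

open Polynomial Filter Topology IntermediateField

/-! ### Involutions with a single fixed point, and the Galois argument -/

theorem semiconjBy_mul_inv {Γ : Type*} [Group Γ] {σ ρ : Γ} (hσ : σ * σ = 1) (hρ : ρ * ρ = 1) :
    SemiconjBy σ (σ * ρ) (σ * ρ)⁻¹ := by
  rw [SemiconjBy, mul_inv_rev, inv_eq_of_mul_eq_one_left hσ, inv_eq_of_mul_eq_one_left hρ,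
    ← mul_assoc, hσ, one_mul, mul_assoc, hσ, mul_one]

theorem conj_mul_conj_eq_one {Γ : Type*} [Group Γ] {τ : Γ} (hτ : τ * τ = 1) (u : Γ) :
    u * τ * u⁻¹ * (u * τ * u⁻¹) = 1 := by
  calc u * τ * u⁻¹ * (u * τ * u⁻¹) = u * (τ * τ) * u⁻¹ := by group
    _ = 1 := by rw [hτ]; group

/-- If the involution `σ` has no fixed point but `ω` in the orbit of `ω` under `σ * ρ`, then that
orbit has odd size: an even period `2m` would make `(σ * ρ) ^ m • ω` fixed by `σ`, so that the
period could be halved. -/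
theorem exists_odd_pow_smul_eq {Γ X : Type*} [Group Γ] [MulAction Γ X] {σ ρ : Γ} {ω : X}
    (hσ : σ * σ = 1) (hρ : ρ * ρ = 1) (hσω : σ • ω = ω)
    (huniq : ∀ n : ℕ, σ • (σ * ρ) ^ n • ω = (σ * ρ) ^ n • ω → (σ * ρ) ^ n • ω = ω)
    {r : ℕ} (hr : 0 < r) (hrω : (σ * ρ) ^ r • ω = ω) :
    ∃ j : ℕ, (σ * ρ) ^ (2 * j + 1) • ω = ω := by
  induction r using Nat.strong_induction_on with
  | _ r ih =>
    rcases Nat.even_or_odd' r with ⟨m, rfl | rfl⟩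
    · refine ih m (by omega) (by omega) (huniq m ?_)
      have hconj : σ * (σ * ρ) ^ m = ((σ * ρ) ^ m)⁻¹ * σ := by
        have h2 := (semiconjBy_mul_inv hσ hρ).pow_right m
        rwa [inv_pow] at h2
      rw [smul_smul, hconj, mul_smul, hσω, inv_smul_eq_iff, smul_smul, ← pow_add, ← two_mul, hrω]
    · exact ⟨m, hrω⟩

/-- If the involution `τ` has the single fixed point `ω` in a finite set `S`, then `ω` and `u • ω`,
the single fixed points of `τ` and of `u * τ * u⁻¹`, are the two ends of one chain of points of
`S` on which these involutions act alternately. -/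
theorem exists_mul_conj_pow_smul_eq {Γ X : Type*} [Group Γ] [MulAction Γ X] {τ u : Γ} {ω : X}
    {S : Set X} (hS : S.Finite) (hωS : ω ∈ S) (hτS : ∀ x ∈ S, τ • x ∈ S)
    (huS : ∀ x ∈ S, u • x ∈ S) (huS' : ∀ x ∈ S, u⁻¹ • x ∈ S)
    (hτ : τ * τ = 1) (hτω : τ • ω = ω) (huniq : ∀ x ∈ S, τ • x = x → x = ω) :
    ∃ k : ℕ, (τ * (u * τ * u⁻¹)) ^ k • ω = u • ω := by
  set ρ := u * τ * u⁻¹ with hρdef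
  have hρ : ρ * ρ = 1 := conj_mul_conj_eq_one hτ u
  have hmem : ∀ n : ℕ, (τ * ρ) ^ n • ω ∈ S := by
    intro n
    induction n with
    | zero => simpa using hωS
    | succ n ih =>
      rw [pow_succ', mul_smul, hρdef, mul_smul, mul_smul, mul_smul]
      exact hτS _ (huS _ (hτS _ (huS' _ ih)))
  obtain ⟨a, -, b, -, hab, heq⟩ := Set.infinite_univ.exists_ne_map_eq_of_mapsTo
    (f := fun n : ℕ => (τ * ρ) ^ n • ω) (fun n _ => hmem n) hS
  obtain ⟨r, hr, hrω⟩ : ∃ r : ℕ, 0 < r ∧ (τ * ρ) ^ r • ω = ω := by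
    wlog hlt : a < b generalizing a b
    · exact this b a hab.symm heq.symm (lt_of_le_of_ne (not_lt.mp hlt) hab.symm)
    refine ⟨b - a, by omega, smul_left_cancel ((τ * ρ) ^ a) ?_⟩
    rw [smul_smul, ← pow_add, Nat.add_sub_cancel' hlt.le]
    exact heq.symm
  obtain ⟨j, hj⟩ := exists_odd_pow_smul_eq hτ hρ hτω (fun n hn => huniq _ (hmem n) hn) hr hrω
  refine ⟨j, ?_⟩
  have hfix : ρ • (τ * ρ) ^ j • ω = (τ * ρ) ^ j • ω := by
    have h2 : ρ * (τ * ρ) ^ j = ((τ * ρ) ^ (j + 1))⁻¹ * τ := by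
      rw [← inv_pow, ← ((semiconjBy_mul_inv hτ hρ).pow_right (j + 1)).eq, pow_succ' _ j,
        mul_assoc τ ρ, ← mul_assoc τ τ, hτ, one_mul]
    rw [smul_smul, h2, mul_smul, hτω, inv_smul_eq_iff, smul_smul, ← pow_add,
      show j + 1 + j = 2 * j + 1 by ring, hj]
  have h3 : u⁻¹ • (τ * ρ) ^ j • ω = ω := by
    refine huniq _ (huS' _ (hmem j)) ?_
    rw [hρdef, mul_smul, mul_smul, ← hρdef] at hfix
    nth_rw 2 [← hfix]
    rw [inv_smul_smul]
  rw [← h3, smul_inv_smul, h3]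

theorem ratFunc_ringHom_ext {k R : Type*} [Field k] [Semiring R] {φ ψ : RatFunc k →+* R}
    (hC : ∀ a, φ (RatFunc.C a) = ψ (RatFunc.C a)) (hX : φ RatFunc.X = ψ RatFunc.X) : φ = ψ :=
  IsLocalization.ringHom_ext (nonZeroDivisors k[X])
    (Polynomial.ringHom_ext (fun a => by simpa using hC a) (by simpa using hX))

/-- The Galois argument. Here `ι` is evaluation at `ω = ι X`, and the involution `τ` of `E`, which
acts on rational functions through `κ`, has `ω` as its only fixed point in a finite set `S` that is
stable under `τ` and under all automorphisms over `k(ι g)`. -/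
theorem conj_mem_adjoin {k E : Type*} [Field k] [Field E] [CharZero k] [IsAlgClosed E]
    [Algebra k E] (ι : RatFunc k →ₐ[k] E) (τ : RingAut E) (hτ : τ * τ = 1)
    (κ : RatFunc k → RatFunc k) (hκ : ∀ r, τ (ι r) = ι (κ r))
    (hκC : ∀ a : k, ∃ b : k, τ (algebraMap k E a) = algebraMap k E b)
    (hω : τ (ι RatFunc.X) = ι RatFunc.X) (S : Set E) (hS : S.Finite) (hωS : ι RatFunc.X ∈ S)
    (hτS : ∀ x ∈ S, τ x ∈ S) (huniq : ∀ x ∈ S, τ x = x → x = ι RatFunc.X) (g : RatFunc k)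
    (hgS : ∀ u : E ≃ₐ[k⟮ι g⟯] E, ∀ x ∈ S, u x ∈ S) [Algebra.IsAlgebraic k⟮ι g⟯ E] :
    τ (ι g) ∈ k⟮ι g⟯ := by
  have hc0 : CharZero k⟮ι g⟯ := charZero_of_injective_algebraMap (algebraMap k k⟮ι g⟯).injective
  have : IsAlgClosure k⟮ι g⟯ E := ⟨inferInstance, inferInstance⟩
  have : Normal k⟮ι g⟯ E := IsAlgClosure.normal _ _
  have : IsGalois k⟮ι g⟯ E := {}
  suffices h : τ (ι g) ∈ (⊥ : IntermediateField k⟮ι g⟯ E) by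
    obtain ⟨y, hy⟩ := IntermediateField.mem_bot.mp h
    rw [← hy]
    exact y.2
  rw [InfiniteGalois.mem_bot_iff_fixed]
  intro u
  let u' : RingAut E := u.toRingEquiv
  have hu' : ∀ x, u' x = u x := fun _ => rfl
  have hui' : ∀ x, u'⁻¹ x = u⁻¹ x := fun _ => rfl
  have hττ : ∀ x, τ (τ x) = x := fun x => DFunLike.congr_fun hτ x
  obtain ⟨n, hn⟩ := exists_mul_conj_pow_smul_eq (Γ := RingAut E) (τ := τ) (u := u') hS hωS
    hτS (hgS u) (hgS u⁻¹) hτ hω huniq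
  set d := (τ * (u' * τ * u'⁻¹)) ^ n with hd
  have huk : ∀ (v : E ≃ₐ[k⟮ι g⟯] E) (a : k), v (algebraMap k E a) = algebraMap k E a := by
    intro v a
    rw [IsScalarTower.algebraMap_apply k k⟮ι g⟯ E, v.commutes]
  have hdk : ∀ a : k, d (algebraMap k E a) = algebraMap k E a := by
    intro a
    rw [hd]
    clear_value d
    clear hd hn
    induction n with
    | zero => rfl
    | succ n ih =>
      rw [pow_succ, RingAut.mul_apply, RingAut.mul_apply, RingAut.mul_apply, RingAut.mul_apply,
        hui', huk]
      obtain ⟨b, hb⟩ := hκC a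
      rw [hb, hu', huk, ← hb, hττ, ih]
  have hdu : ∀ r, d (ι r) = u (ι r) := by
    intro r
    have : (d : E →+* E).comp (ι : RatFunc k →+* E) =
        (u : E →+* E).comp (ι : RatFunc k →+* E) := by
      refine ratFunc_ringHom_ext (fun a => ?_) ?_
      · have : ι (RatFunc.C a) = algebraMap k E a := by
          rw [← RatFunc.algebraMap_eq_C]; exact ι.commutes a
        simp [this, hdk, huk]
      · simpa [hu'] using hn
    exact RingHom.congr_fun this r
  have hug : u (ι g) = ι g := u.commutes ⟨ι g, mem_adjoin_simple_self k _⟩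
  have hdτ : d * τ * d = τ := by
    have h2 := ((semiconjBy_mul_inv hτ (conj_mul_conj_eq_one hτ u')).pow_right n).eq
    rw [inv_pow, ← hd] at h2
    rw [mul_assoc, h2, mul_inv_cancel_left]
  have h1 : d (τ (ι g)) = τ (ι g) := by
    conv_rhs => rw [← hdτ]
    rw [RingAut.mul_apply, RingAut.mul_apply, hdu g, hug]
  rw [hκ] at h1 ⊢
  rw [← hdu, h1]

/-! ### Weak injectivity and nearby real fibres -/

/-- Local injectivity of `p / q`, as a map to the projective line, at a non-critical point. -/
theorem eventually_cross_eq_imp_eq_nhds {p q : ℝ[X]} {z : ℝ}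
    (hD : p.derivative.eval z * q.eval z - p.eval z * q.derivative.eval z ≠ 0) :
    ∀ᶠ x : ℝ × ℝ in 𝓝 (z, z),
      p.eval x.2 * q.eval x.1 = p.eval x.1 * q.eval x.2 → x.2 = x.1 := by
  wlog hq : q.eval z ≠ 0 generalizing p q
  · have hp : p.eval z ≠ 0 := by
      rintro h
      rw [not_not] at hq
      simp [h, hq] at hD
    filter_upwards [this (p := q) (q := p) (by intro h; apply hD; linarith) hp] with x hx h
    exact hx (by linarith)
  have hder : HasStrictDerivAt (fun x => p.eval x / q.eval x)
      ((p.derivative.eval z * q.eval z - p.eval z * q.derivative.eval z) / q.eval z ^ 2) z :=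
    (p.hasStrictDerivAt z).div (q.hasStrictDerivAt z) hq
  have hinv := hder.eventually_left_inverse (div_ne_zero hD (pow_ne_zero 2 hq))
  have hqn : ∀ᶠ x in 𝓝 z, q.eval x ≠ 0 := q.continuous.continuousAt.eventually_ne hq
  rw [nhds_prod_eq]
  filter_upwards [(hinv.and hqn).prod_mk (hinv.and hqn)] with x hx h
  rw [← hx.1.1, ← hx.2.1, (div_eq_div_iff hx.2.2 hx.1.2).mpr h]

theorem eval_inv_reflect (p : ℝ[X]) {n : ℕ} (hn : p.natDegree ≤ n) {y : ℝ} (hy : y ≠ 0) :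
    (reflect n p).eval y⁻¹ * y ^ n = p.eval y := by
  let := invertibleOfNonzero hy
  have := eval₂_reflect_mul_pow (RingHom.id ℝ) y n p hn
  rwa [invOf_eq_inv] at this

/-- If `z` is the only point of the real projective line that `p / q` maps to its image, and is
not critical, the same holds for the nearby `x`, as far as finite points `y` are concerned. The
hypotheses are free of denominators: `hD` is the condition at `z` itself, and `hinf` says that
`∞` has another image than `z`. -/
theorem eventually_cross_eq_imp_eq {p q : ℝ[X]} {z : ℝ} {n : ℕ} (hpn : p.natDegree ≤ n)
    (hqn : q.natDegree ≤ n)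
    (hD : p.derivative.eval z * q.eval z - p.eval z * q.derivative.eval z ≠ 0)
    (hfin : ∀ y : ℝ, p.eval y * q.eval z = p.eval z * q.eval y → y = z)
    (hinf : p.coeff n * q.eval z ≠ p.eval z * q.coeff n) :
    ∀ᶠ x in 𝓝 z, ∀ y : ℝ, p.eval y * q.eval x = p.eval x * q.eval y → y = x := by
  obtain ⟨R, hR0, hRz⟩ : ∃ R : ℝ, 0 < R ∧ |z| < R := ⟨|z| + 1, by positivity, by linarith⟩
  -- The projective line is covered by `|y| ≤ R` and, in the coordinate `s = y⁻¹`, by `|s| ≤ R⁻¹`.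
  have hin : ∀ᶠ x in 𝓝 z, ∀ y ∈ Set.Icc (-R) R,
      p.eval y * q.eval x = p.eval x * q.eval y → y = x := by
    refine isCompact_Icc.eventually_forall_of_forall_eventually fun y _ => ?_
    by_cases hyz : y = z
    · subst hyz
      exact eventually_cross_eq_imp_eq_nhds hD
    · have hc : Continuous fun x : ℝ × ℝ =>
          p.eval x.2 * q.eval x.1 - p.eval x.1 * q.eval x.2 := by fun_prop
      have := hc.continuousAt.eventually_ne (x := (z, y)) (y := 0)
        (sub_ne_zero.mpr fun h => hyz (hfin y h))
      filter_upwards [this] with x hx h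
      exact absurd (sub_eq_zero.mpr h) hx
  have hout : ∀ᶠ x in 𝓝 z, ∀ s ∈ Set.Icc (-R⁻¹) R⁻¹,
      (reflect n p).eval s * q.eval x - p.eval x * (reflect n q).eval s ≠ 0 := by
    refine isCompact_Icc.eventually_forall_of_forall_eventually fun s hs => ?_
    have hc : Continuous fun x : ℝ × ℝ =>
        (reflect n p).eval x.2 * q.eval x.1 - p.eval x.1 * (reflect n q).eval x.2 := by fun_prop
    refine hc.continuousAt.eventually_ne (x := (z, s)) (y := 0) (sub_ne_zero.mpr fun h => ?_)
    by_cases hs0 : s = 0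
    · subst hs0
      -- At `s = 0` the reflected polynomials take the values of the coefficients of degree `n`.
      simp only [← coeff_zero_eq_eval_zero, coeff_reflect, revAt_le (Nat.zero_le n)] at h
      exact hinf (by simpa using h)
    · have h1 := eval_inv_reflect p hpn (inv_ne_zero hs0)
      have h2 := eval_inv_reflect q hqn (inv_ne_zero hs0)
      rw [inv_inv] at h1 h2
      have h3 : s⁻¹ = z := hfin _ (by rw [← h1, ← h2]; linear_combination (s⁻¹ ^ n) * h)
      have h4 : |s| ≤ R⁻¹ := abs_le.mpr hs
      rw [← h3, abs_inv] at hRz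
      exact absurd h4 (not_le.mpr ((inv_lt_comm₀ (abs_pos.mpr hs0) hR0).mp hRz))
  filter_upwards [hin, hout] with x hx1 hx2 y hy
  by_cases hyR : |y| ≤ R
  · exact hx1 y (abs_le.mp hyR) hy
  · have hyR := not_le.mp hyR
    have hy0 : y ≠ 0 := abs_pos.mp (hR0.trans hyR)
    have hs : y⁻¹ ∈ Set.Icc (-R⁻¹) R⁻¹ := by
      rw [Set.mem_Icc, ← abs_le, abs_inv]
      exact inv_anti₀ hR0 hyR.le
    refine absurd ?_ (hx2 _ hs)
    rw [← eval_inv_reflect p hpn hy0, ← eval_inv_reflect q hqn hy0] at hy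
    have : y ^ n ≠ 0 := pow_ne_zero _ hy0
    apply mul_right_cancel₀ this
    linear_combination hy

theorem eval_num_ne_zero_of_eval_denom_eq_zero {h : RatFunc ℝ} {x : ℝ} (hx : h.denom.eval x = 0) :
    h.num.eval x ≠ 0 := by
  intro hn
  obtain ⟨a, b, hab⟩ := h.isCoprime_num_denom
  simpa [hx, hn] using congrArg (Polynomial.eval x) hab

/-- The condition for a non-critical point has one form for poles and for other points, as
`p / q` and `q / p` have the same Wronskian up to sign. -/
theorem wronskian_ne_zero_of_not_isCriticalPoint {h : RatFunc ℝ} {z : ℝ}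
    (hz : ¬ IsCriticalPoint h z) :
    h.num.derivative.eval z * h.denom.eval z - h.num.eval z * h.denom.derivative.eval z ≠ 0 := by
  intro hD
  apply hz
  by_cases hq : h.denom.eval z = 0
  · right
    refine ⟨hq, ?_⟩
    have hp := eval_num_ne_zero_of_eval_denom_eq_zero hq
    have hh : h ≠ 0 := by rintro rfl; simp at hp
    have hev : (fun t : ℝ => h⁻¹.eval (RingHom.id ℝ) t) =ᶠ[𝓝 z]
        fun t => h.denom.eval t / h.num.eval t := by
      filter_upwards [h.num.continuous.continuousAt.eventually_ne hp] with t ht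
      have hd : h⁻¹.denom.eval t ≠ 0 := fun h0 =>
        ht (eval_eq_zero_of_dvd_of_eval_eq_zero (RatFunc.denom_inv_dvd hh) h0)
      have hcross : h⁻¹.num * h.num = h.denom * h⁻¹.denom := by
        rw [RatFunc.num_mul_eq_mul_denom_iff (RatFunc.num_ne_zero hh)]
        conv_lhs => rw [← RatFunc.num_div_denom h, inv_div]
      have := congrArg (Polynomial.eval t) hcross
      rw [eval_mul, eval_mul] at this
      exact (div_eq_div_iff hd ht).mpr this
    rw [hev.deriv_eq]
    have := ((h.denom.hasDerivAt z).div (h.num.hasDerivAt z) hp).deriv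
    refine this.trans ?_
    rw [div_eq_zero_iff]
    left
    linarith
  · left
    refine ⟨hq, ?_⟩
    have := ((h.num.hasDerivAt z).div (h.denom.hasDerivAt z) hq).deriv
    exact this.trans (by rw [hD, zero_div])

/-- Weak injectivity is an open condition on `x`; the equation says `h y = h x`. -/
theorem WeaklyInjective.exists_eventually {h : RatFunc ℝ} (hinj : WeaklyInjective h) :
    ∃ z : ℝ, ∀ᶠ x in 𝓝 z, ∀ y : ℝ,
      h.num.eval y * h.denom.eval x = h.num.eval x * h.denom.eval y → y = x := by
  obtain ⟨z, hz, huniq⟩ := hinj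
  refine ⟨z, eventually_cross_eq_imp_eq (le_max_left _ _) (le_max_right _ _)
    (wronskian_ne_zero_of_not_isCriticalPoint hz) ?_ ?_⟩
  · intro y hy
    refine OnePoint.coe_injective (huniq y ?_)
    by_cases hqz : h.denom.eval z = 0
    · have hpz := eval_num_ne_zero_of_eval_denom_eq_zero hqz
      have hqy : h.denom.eval y = 0 := by simpa [hqz, hpz] using hy
      simp [proj, hqz, hqy]
    · have hqy : h.denom.eval y ≠ 0 := fun h0 =>
        eval_num_ne_zero_of_eval_denom_eq_zero h0 (by simpa [h0, hqz] using hy)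
      simp only [proj, hqz, hqy, if_false]
      rw [(div_eq_div_iff hqy hqz).mpr hy]
  · intro hy
    refine OnePoint.infty_ne_coe z (huniq OnePoint.infty ?_)
    by_cases hdeg : h.denom.natDegree < h.num.natDegree
    · rw [max_eq_left hdeg.le, coeff_natDegree, coeff_eq_zero_of_natDegree_lt hdeg, mul_zero,
        mul_eq_zero, leadingCoeff_eq_zero] at hy
      have hqz : h.denom.eval z = 0 := hy.resolve_left (by rintro h0; simp [h0] at hdeg)
      simp [proj, hdeg, hqz]
    · rw [max_eq_right (not_lt.mp hdeg), coeff_natDegree, (RatFunc.monic_denom h).leadingCoeff,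
        mul_one] at hy
      have hqz : h.denom.eval z ≠ 0 := fun h0 =>
        eval_num_ne_zero_of_eval_denom_eq_zero h0 (by simpa [h0] using hy.symm)
      simp only [proj, hdeg, hqz, if_false]
      rw [← hy, mul_div_cancel_right₀ _ hqz]

/-! ### Passage to an algebraically closed field -/

/-- The conclusion of `conj_mem_adjoin` for `h = p / q ∈ k(g)` fixed by `κ`, where `ω = ι X` is the
only `τ`-fixed solution of `p(x) = h(ω) q(x)`; `Ω` may be transcendental over `k(ω)`. -/
theorem conj_mem_adjoin_of_isAlgClosed {k Ω : Type*} [Field k] [Field Ω] [CharZero k]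
    [IsAlgClosed Ω] [Algebra k Ω] (ι : RatFunc k →ₐ[k] Ω) (τ : RingAut Ω) (hτ : τ * τ = 1)
    (κ : RatFunc k → RatFunc k) (hκ : ∀ r, τ (ι r) = ι (κ r))
    (hκC : ∀ a : k, ∃ b : k, τ (algebraMap k Ω a) = algebraMap k Ω b)
    (hκX : κ RatFunc.X = RatFunc.X) {g h : RatFunc k} (hgh : h ∈ k⟮g⟯) (hκh : κ h = h)
    (hh : ∀ c, h ≠ RatFunc.C c) {p q : k[X]} (hq : q ≠ 0)
    (hpq : algebraMap _ (RatFunc k) p = h * algebraMap _ (RatFunc k) q)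
    (hτp : ∀ x, τ (aeval x p) = aeval (τ x) p) (hτq : ∀ x, τ (aeval x q) = aeval (τ x) q)
    (huniq : ∀ x, aeval x p = ι h * aeval x q → τ x = x → x = ι RatFunc.X) :
    κ g ∈ k⟮g⟯ := by
  set t := ι h with ht
  let tt : k⟮t⟯ := AdjoinSimple.gen k t
  have htt : algebraMap k⟮t⟯ Ω tt = t := rfl
  let P : k⟮t⟯[X] := p.map (algebraMap k k⟮t⟯) - C tt * q.map (algebraMap k k⟮t⟯)
  have hP0 : P ≠ 0 := by
    intro hP
    obtain ⟨i, hi⟩ : ∃ i, q.coeff i ≠ 0 := by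
      by_contra! h0
      exact hq (Polynomial.ext h0)
    have h1 := congrArg (algebraMap k⟮t⟯ Ω) (congrArg (fun Q => Q.coeff i) hP)
    simp only [P, coeff_sub, coeff_C_mul, coeff_map, map_sub, map_mul, coeff_zero, map_zero, htt,
      ← IsScalarTower.algebraMap_apply k k⟮t⟯ Ω] at h1
    refine hh (p.coeff i / q.coeff i) (ι.toRingHom.injective ?_)
    have h2 : ∀ a : k, ι (RatFunc.C a) = algebraMap k Ω a := fun a => by
      rw [← RatFunc.algebraMap_eq_C]; exact ι.commutes a
    change t = ι _
    rw [map_div₀, map_div₀, h2, h2, eq_div_iff (by simpa using hi)]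
    exact (sub_eq_zero.mp h1).symm
  have hPx : ∀ x : Ω, aeval x P = aeval x p - t * aeval x q := by
    intro x
    simp [P, htt, aeval_map_algebraMap]
  -- Generating `L` from the `τ`-fixed element `t` makes its stability under `τ` evident. It
  -- contains the fibre, hence also `ω` and the image of `ι`.
  let L := algebraicClosure k⟮t⟯ Ω
  have : IsScalarTower k L Ω := IsScalarTower.of_algebraMap_eq fun _ => rfl
  have hroot : ∀ x : Ω, aeval x P = 0 → x ∈ L := fun x hx =>
    mem_algebraicClosure_iff.mpr ⟨P, hP0, hx⟩
  have hιp : ∀ r : k[X], ι (algebraMap _ _ r) = aeval (ι RatFunc.X) r := by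
    intro r
    rw [← RatFunc.aeval_X_left_eq_algebraMap, aeval_algHom_apply]
  have hXP : aeval (ι RatFunc.X) P = 0 := by
    rw [hPx, ← hιp, ← hιp, hpq, map_mul, ht, sub_self]
  have hιL : ∀ r, ι r ∈ L.restrictScalars k := by
    intro r
    have h1 : k⟮(RatFunc.X : RatFunc k)⟯ ≤ (L.restrictScalars k).comap ι := by
      rw [adjoin_simple_le_iff]
      exact hroot _ hXP
    rw [RatFunc.adjoin_X] at h1
    exact h1 mem_top
  let ι' : RatFunc k →ₐ[k] L := ι.codRestrict (L.restrictScalars k).toSubalgebra hιL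
  have hι' : ∀ r, (ι' r : Ω) = ι r := fun _ => rfl
  have hτt : τ t = t := by rw [ht, hκ, hκh]
  have hττ : ∀ x, τ (τ x) = x := fun x => DFunLike.congr_fun hτ x
  have hτF : ∀ x ∈ k⟮t⟯, τ x ∈ k⟮t⟯ := by
    intro x hx
    induction hx using adjoin_induction with
    | mem x hx =>
      rw [Set.mem_singleton_iff.mp hx, hτt]
      exact mem_adjoin_simple_self k t
    | algebraMap a =>
      obtain ⟨b, hb⟩ := hκC a
      rw [hb]
      exact IntermediateField.algebraMap_mem _ b
    | add x y _ _ hx hy => rw [map_add]; exact add_mem hx hy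
    | mul x y _ _ hx hy => rw [map_mul]; exact mul_mem hx hy
    | inv x _ hx => rw [map_inv₀]; exact inv_mem hx
  let τF : k⟮t⟯ →+* k⟮t⟯ := (τ : Ω →+* Ω).restrict k⟮t⟯ k⟮t⟯ hτF
  have hτL : ∀ x ∈ L, τ x ∈ L := by
    intro x hx
    obtain ⟨Q, hQ0, hQ⟩ := mem_algebraicClosure_iff.mp hx
    refine mem_algebraicClosure_iff.mpr ⟨Q.map τF, ?_, ?_⟩
    · exact (Polynomial.map_ne_zero_iff τF.injective).mpr hQ0
    · rw [aeval_def, eval₂_map]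
      have : (algebraMap k⟮t⟯ Ω).comp τF = (τ : Ω →+* Ω).comp (algebraMap k⟮t⟯ Ω) := rfl
      rw [this]
      have := hom_eval₂ Q (algebraMap k⟮t⟯ Ω) (τ : Ω →+* Ω) x
      rw [← aeval_def, hQ, map_zero] at this
      exact this.symm
  let τ₀ : L →+* L := (τ : Ω →+* Ω).restrict L L hτL
  have hτ₀ : τ₀.comp τ₀ = RingHom.id L := RingHom.ext fun x => Subtype.ext (hττ x)
  let τ' : RingAut L := RingEquiv.ofRingHom τ₀ τ₀ hτ₀ hτ₀
  have hτ' : ∀ x, (τ' x : Ω) = τ x := fun _ => rfl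
  have hcoe : ∀ (x : L) (r : k[X]), ((aeval x r : L) : Ω) = aeval (x : Ω) r := fun x r =>
    (aeval_algebraMap_apply Ω x r).symm
  let S : Set L := {x | aeval x p = ι' h * aeval x q}
  have hSΩ : ∀ x : L, x ∈ S ↔ aeval (x : Ω) p = t * aeval (x : Ω) q := by
    intro x
    rw [← hcoe, ← hcoe]
    exact Subtype.ext_iff
  have hSfin : S.Finite := by
    refine Set.Finite.of_finite_image (f := ((↑) : L → Ω)) ?_ Subtype.val_injective.injOn
    refine (P.rootSet_finite Ω).subset ?_
    rintro _ ⟨x, hx, rfl⟩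
    rw [mem_rootSet, hPx, (hSΩ x).mp hx, sub_self]
    exact ⟨hP0, rfl⟩
  have hhg : ι' h ∈ k⟮ι' g⟯ := by
    have h1 : ι' h ∈ (k⟮g⟯).map ι' := ⟨h, hgh, rfl⟩
    rwa [adjoin_map, Set.image_singleton] at h1
  have hFg : ∀ c : k⟮t⟯, algebraMap k⟮t⟯ L c ∈ k⟮ι' g⟯ := by
    have h1 : k⟮t⟯ ≤ (k⟮ι' g⟯).map (IsScalarTower.toAlgHom k L Ω) := by
      rw [adjoin_simple_le_iff]
      exact ⟨ι' h, hhg, rfl⟩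
    intro c
    obtain ⟨y, hy, hyc⟩ := h1 c.2
    have : y = algebraMap k⟮t⟯ L c := Subtype.ext hyc
    exact this ▸ hy
  let := ((algebraMap k⟮t⟯ L).codRestrict k⟮ι' g⟯ hFg).toAlgebra
  have : IsScalarTower k⟮t⟯ k⟮ι' g⟯ L := IsScalarTower.of_algebraMap_eq fun _ => rfl
  have : Algebra.IsAlgebraic k⟮ι' g⟯ L := Algebra.IsAlgebraic.tower_top (K := k⟮t⟯) k⟮ι' g⟯
  have : IsAlgClosed L := IsAlgClosure.isAlgClosed k⟮t⟯
  have hκ' : ∀ r, τ' (ι' r) = ι' (κ r) := fun r => Subtype.ext (hκ r)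
  have key := conj_mem_adjoin ι' τ' (RingEquiv.ext fun x => Subtype.ext (hττ x)) κ hκ'
    (fun a => (hκC a).imp fun b hb => Subtype.ext hb) (by rw [hκ', hκX]) S hSfin
    ((hSΩ _).mpr (by rw [hι', ← sub_eq_zero, ← hPx, hXP]))
    (fun x hx => by
      rw [hSΩ] at hx ⊢
      rw [hτ', ← hτp, ← hτq, hx, map_mul, hτt])
    (fun x hx hτx => Subtype.ext (huniq x ((hSΩ x).mp hx) (congrArg Subtype.val hτx))) g
    (fun u x hx => by
      have huk : ∀ r : k[X], u (aeval x r) = aeval (u x) r := fun r =>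
        (aeval_algHom_apply (u.toAlgHom.restrictScalars k) x r).symm
      have huh : u (ι' h) = ι' h := u.commutes ⟨ι' h, hhg⟩
      change aeval (u x) p = ι' h * aeval (u x) q
      have hx : aeval x p = ι' h * aeval x q := hx
      rw [← huk, ← huk, hx, map_mul, huh])
  rw [hκ'] at key
  have h1 : ι' (κ g) ∈ (k⟮g⟯).map ι' := by rwa [adjoin_map, Set.image_singleton]
  obtain ⟨y, hy, hyg⟩ := h1
  exact ι'.toRingHom.injective hyg ▸ hy

/-! ### Germs along an ultrafilter, and conjugation -/

/-- Germs of functions as an algebra over the constants. -/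
instance germAlgebra {α : Type*} (l : Filter α) (R : Type*) [CommSemiring R] :
    Algebra R (Germ l R) :=
  ((Germ.coeRingHom l).comp (Pi.constRingHom α R)).toAlgebra

theorem aeval_germ {α : Type*} (l : Filter α) {R : Type*} [CommSemiring R] (b : α → R) (P : R[X]) :
    aeval (b : Germ l R) P = ((fun x => P.eval (b x) : α → R) : Germ l R) := by
  have h1 : aeval (b : Germ l R) P = Germ.coeRingHom l (P.eval₂ (Pi.constRingHom α R) b) :=
    (hom_eval₂ P (Pi.constRingHom α R) (Germ.coeRingHom l) b).symm
  rw [h1]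
  exact congrArg (fun f : α → R => (f : Germ l R)) (funext fun x =>
    hom_eval₂ P (Pi.constRingHom α R) (Pi.evalRingHom (fun _ => R) x) b)

/-- A root of a monic polynomial over the germs is obtained by choosing roots pointwise. -/
instance isAlgClosed_germ {α K : Type*} [Field K] [IsAlgClosed K] (φ : Ultrafilter α) :
    IsAlgClosed (Germ (φ : Filter α) K) := by
  refine IsAlgClosed.of_exists_root _ fun p hp hirr => ?_
  have hd : 0 < p.natDegree := hirr.natDegree_pos
  choose c hc using fun i => Quotient.exists_rep (p.coeff i)
  have hroot : ∀ a : α, ∃ x : K,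
      x ^ p.natDegree + ∑ i ∈ Finset.range p.natDegree, c i a * x ^ i = 0 := by
    intro a
    let P : K[X] := X ^ p.natDegree + ∑ i ∈ Finset.range p.natDegree, C (c i a) * X ^ i
    have hlt : (∑ i ∈ Finset.range p.natDegree, C (c i a) * X ^ i : K[X]).degree
        < p.natDegree := by
      refine (degree_sum_le _ _).trans_lt ?_
      rw [Finset.sup_lt_iff (WithBot.bot_lt_coe _)]
      intro i hi
      exact (degree_C_mul_X_pow_le i _).trans_lt (by exact_mod_cast Finset.mem_range.mp hi)
    have hP : P.degree = p.natDegree := by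
      rw [← degree_X_pow (R := K) p.natDegree] at hlt ⊢
      exact degree_add_eq_left_of_degree_lt hlt
    obtain ⟨x, hx⟩ := IsAlgClosed.exists_root P (by
      rw [hP]; exact_mod_cast hd.ne')
    exact ⟨x, by simpa [P, IsRoot, eval_finsetSum] using hx⟩
  choose b hb using hroot
  refine ⟨(b : Germ (φ : Filter α) K), ?_⟩
  have h1 : Germ.coeRingHom (φ : Filter α)
      (b ^ p.natDegree + ∑ i ∈ Finset.range p.natDegree, c i * b ^ i) = 0 := by
    have : b ^ p.natDegree + ∑ i ∈ Finset.range p.natDegree, c i * b ^ i = 0 := by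
      funext a
      simpa using hb a
    rw [this, map_zero]
  rw [map_add, map_sum, map_pow] at h1
  rw [eval_eq_sum_range, Finset.sum_range_succ, hp.coeff_natDegree, one_mul, add_comm, ← h1]
  congr 1
  refine Finset.sum_congr rfl fun i _ => ?_
  rw [map_mul, map_pow, ← hc i]
  rfl

/-- The germ of an injective function is transcendental at a limit point, as a polynomial has only
finitely many roots. -/
theorem transcendental_germ_of_injective {K : Type*} [Field K] {φ : Filter ℝ} [φ.NeBot] (f : ℝ → K)
    (hf : Function.Injective f) {z : ℝ}
    (hφ : φ ≤ 𝓝[≠] z) : Transcendental K (f : Germ φ K) := by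
  rintro ⟨P, hP0, hP⟩
  rw [aeval_germ] at hP
  have h1 : ∀ᶠ x in φ, P.eval (f x) = 0 := Germ.coe_eq.mp hP
  have h2 : ∀ᶠ x in φ, P.eval (f x) ≠ 0 := by
    refine hφ ?_
    have hfin : {x : ℝ | P.eval (f x) = 0}.Finite :=
      Set.Finite.of_finite_image (f := f)
        ((P.rootSet_finite K).subset (by
          rintro _ ⟨x, hx, rfl⟩
          rw [mem_rootSet]
          exact ⟨hP0, hx⟩)) hf.injOn
    exact nhdsNE_le_cofinite z hfin.compl_mem_cofinite
  obtain ⟨x, hx1, hx2⟩ := (h1.and h2).exists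
  exact hx2 hx1

/-- Complex conjugation of germs of complex valued functions. -/
def germConj {α : Type*} (l : Filter α) : RingAut (Germ l ℂ) :=
  have hinv : Function.Involutive (Germ.map (l := l) (starRingEnd ℂ)) := fun x => by
    induction x using Germ.inductionOn with
    | _ x => exact congrArg _ (funext fun a => Complex.conj_conj (x a))
  { hinv.toPerm with
    map_mul' := fun x y => Germ.inductionOn₂ x y fun a b =>
      congrArg (fun f : α → ℂ => (f : Germ l ℂ)) (funext fun i => map_mul _ (a i) (b i))
    map_add' := fun x y => Germ.inductionOn₂ x y fun a b =>
      congrArg (fun f : α → ℂ => (f : Germ l ℂ)) (funext fun i => map_add _ (a i) (b i)) }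

theorem germConj_coe {α : Type*} (l : Filter α) (b : α → ℂ) :
    germConj l (b : Germ l ℂ) = ((fun x => starRingEnd ℂ (b x) : α → ℂ) : Germ l ℂ) := rfl

theorem germConj_mul_self {α : Type*} (l : Filter α) : germConj l * germConj l = 1 :=
  RingEquiv.ext fun x => Germ.inductionOn x fun b =>
    congrArg (fun f : α → ℂ => (f : Germ l ℂ)) (funext fun i => Complex.conj_conj (b i))

/-- The homomorphism of fields of rational functions that applies `σ` to the coefficients. -/
noncomputable def mapCoeff {K L : Type*} [Field K] [Field L] (σ : K →+* L) :
    RatFunc K →+* RatFunc L :=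
  RatFunc.mapRingHom (Polynomial.mapRingHom σ)
    (nonZeroDivisors_le_comap_nonZeroDivisors_of_injective _
      (Polynomial.map_injective _ σ.injective))

theorem mapCoeff_algebraMap {K L : Type*} [Field K] [Field L] (σ : K →+* L) (p : K[X]) :
    mapCoeff σ (algebraMap _ _ p) = algebraMap _ _ (p.map σ) := by
  have := RatFunc.map_apply_div (Polynomial.mapRingHom σ)
    (nonZeroDivisors_le_comap_nonZeroDivisors_of_injective _
      (Polynomial.map_injective _ σ.injective)) p 1
  rw [← RatFunc.coe_mapRingHom_eq_coe_map] at this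
  simpa [mapCoeff] using this

/-- Complex conjugation of the coefficients of a rational function. -/
noncomputable abbrev conjRatFunc : RatFunc ℂ →+* RatFunc ℂ := mapCoeff (starRingEnd ℂ)

/-- The inclusion of `ℝ(z)` into `ℂ(z)` as a ring homomorphism. -/
noncomputable abbrev toComplexHom : RatFunc ℝ →+* RatFunc ℂ := mapCoeff (algebraMap ℝ ℂ)

theorem toComplexHom_apply (h : RatFunc ℝ) : toComplexHom h = toComplex h := by
  have : ∀ p : ℝ[X], p.eval₂ (RatFunc.C.comp (algebraMap ℝ ℂ)) RatFunc.X =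
      algebraMap _ (RatFunc ℂ) (p.map (algebraMap ℝ ℂ)) := by
    intro p
    rw [← RatFunc.aeval_X_left_eq_algebraMap, aeval_def, eval₂_map, RatFunc.algebraMap_eq_C]
  rw [toComplex, RatFunc.eval, this, this, ← mapCoeff_algebraMap, ← mapCoeff_algebraMap,
    ← map_div₀, RatFunc.num_div_denom]

theorem conjRatFunc_toComplexHom (h : RatFunc ℝ) :
    conjRatFunc (toComplexHom h) = toComplexHom h := by
  have : conjRatFunc.comp toComplexHom = toComplexHom := by
    refine IsLocalization.ringHom_ext (nonZeroDivisors ℝ[X]) (RingHom.ext fun p => ?_)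
    simp only [RingHom.comp_apply, mapCoeff_algebraMap, mapCoeff_algebraMap,
      Polynomial.map_map]
    congr 2
    ext x
    exact Complex.conj_ofReal x
  exact RingHom.congr_fun this h

theorem conjRatFunc_conjRatFunc (r : RatFunc ℂ) : conjRatFunc (conjRatFunc r) = r := by
  have : conjRatFunc.comp conjRatFunc = RingHom.id _ := by
    refine IsLocalization.ringHom_ext (nonZeroDivisors ℂ[X]) (RingHom.ext fun p => ?_)
    simp [mapCoeff_algebraMap, Polynomial.map_map]
  exact RingHom.congr_fun this r

theorem exists_real_of_map_conj_eq {p : ℂ[X]} (hp : p.map (starRingEnd ℂ) = p) :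
    ∃ q : ℝ[X], q.map (algebraMap ℝ ℂ) = p := by
  refine (Polynomial.mem_lifts p).mp ((Polynomial.lifts_iff_coeff_lifts p).mpr fun n => ?_)
  have := congrArg (fun r => r.coeff n) hp
  simp only [coeff_map] at this
  obtain ⟨r, hr⟩ := Complex.conj_eq_iff_real.mp this
  exact ⟨r, hr.symm⟩

/-- Multiplying numerator and denominator by the conjugate of the denominator makes both real. -/
theorem exists_toComplexHom_eq {r : RatFunc ℂ} (hr : conjRatFunc r = r) :
    ∃ h, toComplexHom h = r := by
  have key : ∀ p : ℂ[X], conjRatFunc (algebraMap _ _ p) = algebraMap _ _ p →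
      ∃ h, toComplexHom h = algebraMap _ _ p := by
    intro p hp
    rw [mapCoeff_algebraMap] at hp
    obtain ⟨q, hq⟩ := exists_real_of_map_conj_eq (RatFunc.algebraMap_injective ℂ hp)
    exact ⟨algebraMap _ _ q, by rw [mapCoeff_algebraMap, hq]⟩
  set d : RatFunc ℂ := algebraMap _ _ r.denom with hd
  have hd0 : d ≠ 0 := RatFunc.algebraMap_ne_zero r.denom_ne_zero
  have hdc : conjRatFunc d = algebraMap _ _ (r.denom.map (starRingEnd ℂ)) :=
    mapCoeff_algebraMap _ _
  have hdc0 : conjRatFunc d ≠ 0 := (_root_.map_ne_zero _).mpr hd0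
  have hn : algebraMap _ _ r.num = r * d := by
    rw [← div_eq_iff hd0, hd, RatFunc.num_div_denom]
  obtain ⟨a, ha⟩ := key (r.denom * r.denom.map (starRingEnd ℂ)) (by
    rw [map_mul, ← hdc, ← hd, map_mul, conjRatFunc_conjRatFunc, mul_comm])
  obtain ⟨b, hb⟩ := key (r.num * r.denom.map (starRingEnd ℂ)) (by
    rw [map_mul, ← hdc, hn, map_mul, map_mul, hr, conjRatFunc_conjRatFunc]; ring)
  rw [map_mul, ← hdc, ← hd] at ha
  rw [map_mul, ← hdc, hn] at hb
  refine ⟨b / a, ?_⟩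
  rw [map_div₀, ha, hb]
  field_simp

/-! ### Descent to the real numbers -/

theorem mapCoeff_C {K L : Type*} [Field K] [Field L] (σ : K →+* L) (a : K) :
    mapCoeff σ (RatFunc.C a) = RatFunc.C (σ a) := by
  rw [← RatFunc.algebraMap_C, mapCoeff_algebraMap, Polynomial.map_C, RatFunc.algebraMap_C]

theorem mapCoeff_X {K L : Type*} [Field K] [Field L] (σ : K →+* L) :
    mapCoeff σ RatFunc.X = RatFunc.X := by
  rw [← RatFunc.algebraMap_X, mapCoeff_algebraMap, Polynomial.map_X, RatFunc.algebraMap_X]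

theorem comp_eq_div {K : Type*} [Field K] (f g : RatFunc K) :
    comp f g = aeval g f.num / aeval g f.denom := by
  rw [comp, RatFunc.eval, aeval_def, aeval_def, RatFunc.algebraMap_eq_C]

theorem comp_mem_adjoin {K : Type*} [Field K] (f g : RatFunc K) : comp f g ∈ K⟮g⟯ := by
  rw [comp_eq_div]
  have h : ∀ p : K[X], aeval g p ∈ K⟮g⟯ := fun p =>
    algebra_adjoin_le_adjoin K {g} (aeval_mem_adjoin_singleton K g)
  exact div_mem (h _) (h _)

/-- The degree of `K(z)` over `K(l)` is the larger of the degrees of numerator and denominator. -/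
theorem isLinearFractional_of_adjoin_eq_top {K : Type*} [Field K] {l : RatFunc K}
    (hl : K⟮l⟯ = ⊤) : IsLinearFractional l := by
  have hdeg := l.finrank_eq_max_natDegree
  rw [hl, IntermediateField.finrank_top] at hdeg
  have hn := eq_X_add_C_of_natDegree_le_one (p := l.num) (by omega)
  have hd := eq_X_add_C_of_natDegree_le_one (p := l.denom) (by omega)
  set a := l.num.coeff 1
  set b := l.num.coeff 0
  set c := l.denom.coeff 1
  set d := l.denom.coeff 0
  refine ⟨a, b, c, d, fun h0 => ?_, ?_⟩
  · have h1 : ∀ x y : K, y ≠ 0 → C y * l.num = C x * l.denom → False := by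
      intro x y hy hxy
      have : l = RatFunc.C (x / y) := by
        rw [← RatFunc.num_div_denom l, div_eq_iff (RatFunc.algebraMap_ne_zero l.denom_ne_zero),
          map_div₀, div_mul_eq_mul_div, eq_div_iff (by simpa using hy), mul_comm,
          ← RatFunc.algebraMap_C, ← RatFunc.algebraMap_C, ← map_mul, ← map_mul, hxy]
      obtain ⟨hn0, hd0⟩ := l.eq_C_iff.mp ⟨_, this⟩
      omega
    have h0' : C a * C d = C b * C c := by
      rw [← C_mul, ← C_mul, sub_eq_zero.mp h0]
    by_cases hc : c = 0
    · have hd0 : d ≠ 0 := by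
        intro hd0
        apply l.denom_ne_zero
        rw [hd, hc, hd0]
        simp
      refine h1 b d hd0 ?_
      rw [hn, hd]
      linear_combination X * h0'
    · refine h1 a c hc ?_
      rw [hn, hd]
      linear_combination -h0'
  · conv_lhs => rw [← RatFunc.num_div_denom l, hn, hd]
    simp

/-- If `ℂ(g)` is stable under conjugation, then it is generated by a real rational function, and
this generator is linear fractional in `g`. -/
theorem exists_isReal_comp {g : RatFunc ℂ} (hg : ¬ IsConst g) (hcg : conjRatFunc g ∈ ℂ⟮g⟯) :
    ∃ l : RatFunc ℂ, IsLinearFractional l ∧ IsReal (comp l g) := by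
  have hI : conjRatFunc (RatFunc.C Complex.I) = -RatFunc.C Complex.I := by
    rw [mapCoeff_C, Complex.conj_I, map_neg]
  have hCmem : ∀ (F : IntermediateField ℂ (RatFunc ℂ)) (a : ℂ), RatFunc.C a ∈ F := fun F a => by
    rw [← RatFunc.algebraMap_eq_C]; exact F.algebraMap_mem a
  let T : RatFunc ℝ →ₐ[ℝ] RatFunc ℂ :=
    { toComplexHom with
      commutes' := fun r => by
        rw [IsScalarTower.algebraMap_apply ℝ ℂ (RatFunc ℂ), RatFunc.algebraMap_eq_C,
          RatFunc.algebraMap_eq_C]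
        exact mapCoeff_C _ r }
  have hT : ∀ r, T r = toComplexHom r := fun _ => rfl
  let M : IntermediateField ℝ (RatFunc ℝ) := (ℂ⟮g⟯.restrictScalars ℝ).comap T
  obtain ⟨s, hs⟩ : ∃ s, M = ℝ⟮s⟯ := ⟨_, RatFunc.Luroth.eq_adjoin_generator⟩
  have hsg : T s ∈ ℂ⟮g⟯ := by
    have : s ∈ M := hs ▸ mem_adjoin_simple_self ℝ s
    exact this
  have hreal : ∀ r ∈ ℂ⟮g⟯, conjRatFunc r = r → r ∈ ℂ⟮T s⟯ := by
    intro r hr hrr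
    obtain ⟨m, rfl⟩ := exists_toComplexHom_eq hrr
    have h1 : M ≤ (ℂ⟮T s⟯.restrictScalars ℝ).comap T := by
      rw [hs, adjoin_simple_le_iff]
      exact mem_adjoin_simple_self ℂ (T s)
    exact h1 (show m ∈ M from hr)
  have hgs : g ∈ ℂ⟮T s⟯ := by
    have hg' := mem_adjoin_simple_self ℂ g
    have h1 := hreal (g + conjRatFunc g) (add_mem hg' hcg)
      (by rw [map_add, conjRatFunc_conjRatFunc, add_comm])
    have h2 := hreal (RatFunc.C Complex.I * (g - conjRatFunc g))
      (mul_mem (hCmem _ _) (sub_mem hg' hcg))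
      (by rw [map_mul, map_sub, conjRatFunc_conjRatFunc, hI]; ring)
    have hI2 : RatFunc.C Complex.I * RatFunc.C Complex.I = (-1 : RatFunc ℂ) := by
      rw [← map_mul, Complex.I_mul_I, map_neg, map_one]
    -- The real part of `g` plus `i` times its imaginary part.
    have h3 : g = RatFunc.C (1 / 2) * ((g + conjRatFunc g)
        - RatFunc.C Complex.I * (RatFunc.C Complex.I * (g - conjRatFunc g))) := by
      have h4 : RatFunc.C (1 / 2 : ℂ) * 2 = 1 := by
        rw [← map_ofNat (RatFunc.C (K := ℂ)) 2, ← map_mul]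
        norm_num
      linear_combination (-g) * h4 + RatFunc.C (1 / 2) * (g - conjRatFunc g) * hI2
    rw [h3]
    exact mul_mem (hCmem _ _) (sub_mem h1 (mul_mem (hCmem _ _) h2))
  have htr : Transcendental ℂ g := RatFunc.transcendental_of_ne_C g hg
  let e := RatFunc.algEquivOfTranscendental g htr
  let l := e.symm ⟨T s, hsg⟩
  have hel : (e l : RatFunc ℂ) = T s := by simp [l]
  have hcomp : comp l g = T s := by
    rw [comp_eq_div, ← hel, RatFunc.algEquivOfTranscendental_apply]
  refine ⟨l, isLinearFractional_of_adjoin_eq_top ?_, s, ?_⟩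
  · let ε : RatFunc ℂ →ₐ[ℂ] RatFunc ℂ := ℂ⟮g⟯.val.comp e.toAlgHom
    have hεl : ε l = T s := hel
    have hεX : ε RatFunc.X = g :=
      RatFunc.algEquivOfTranscendental_X g htr
    have h1 : ε RatFunc.X ∈ ℂ⟮l⟯.map ε := by
      rw [adjoin_map, Set.image_singleton, hεl, hεX]
      exact hgs
    obtain ⟨y, hy, hyX⟩ := h1
    have hX : RatFunc.X ∈ ℂ⟮l⟯ := ε.toRingHom.injective hyX ▸ hy
    rw [eq_top_iff, ← RatFunc.adjoin_X, adjoin_simple_le_iff]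
    exact hX
  · rw [hcomp, hT, toComplexHom_apply]

/-- The Galois argument applies in the field of germs at a punctured neighbourhood of the point
given by weak injectivity. -/
theorem conjRatFunc_mem_adjoin {f g : RatFunc ℂ} {h : RatFunc ℝ}
    (hfg : toComplex h = comp f g) (hinj : WeaklyInjective h) : conjRatFunc g ∈ ℂ⟮g⟯ := by
  obtain ⟨z, hz⟩ := hinj.exists_eventually
  let φ : Ultrafilter ℝ := Ultrafilter.of (𝓝[≠] z)
  have hφ : (φ : Filter ℝ) ≤ 𝓝[≠] z := Ultrafilter.of_le _
  let Ω := Germ (φ : Filter ℝ) ℂ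
  let ω : Ω := ((fun x : ℝ => (x : ℂ) : ℝ → ℂ) : Ω)
  have hω : Transcendental ℂ ω := transcendental_germ_of_injective _ Complex.ofReal_injective hφ
  let ι : RatFunc ℂ →ₐ[ℂ] Ω := ℂ⟮ω⟯.val.comp (RatFunc.algEquivOfTranscendental ω hω).toAlgHom
  have hιX : ι RatFunc.X = ω := RatFunc.algEquivOfTranscendental_X ω hω
  have hιC : ∀ a, ι (RatFunc.C a) = ((fun _ => a : ℝ → ℂ) : Ω) := fun a => by
    rw [← RatFunc.algebraMap_eq_C]; exact ι.commutes a
  let τ : RingAut Ω := germConj (φ : Filter ℝ)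
  have hτω : τ ω = ω := by
    change germConj (φ : Filter ℝ) _ = _
    rw [germConj_coe]
    exact congrArg (fun f : ℝ → ℂ => (f : Ω)) (funext fun x => Complex.conj_ofReal x)
  have hκ : ∀ r, τ (ι r) = ι (conjRatFunc r) := by
    have : (τ : Ω →+* Ω).comp (ι : RatFunc ℂ →+* Ω) = (ι : RatFunc ℂ →+* Ω).comp conjRatFunc := by
      refine ratFunc_ringHom_ext (fun a => ?_) ?_
      · change τ (ι (RatFunc.C a)) = ι (conjRatFunc (RatFunc.C a))
        rw [mapCoeff_C, hιC, hιC]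
        rfl
      · change τ (ι RatFunc.X) = ι (conjRatFunc RatFunc.X)
        rw [mapCoeff_X, hιX, hτω]
    exact RingHom.congr_fun this
  have hτp : ∀ (r : ℝ[X]) (x : Ω),
      τ (aeval x (r.map (algebraMap ℝ ℂ))) = aeval (τ x) (r.map (algebraMap ℝ ℂ)) := by
    intro r x
    induction x using Germ.inductionOn with
    | _ b =>
      change germConj (φ : Filter ℝ) _ = aeval (germConj (φ : Filter ℝ) _) _
      rw [germConj_coe, aeval_germ, aeval_germ, germConj_coe]
      refine congrArg (fun f : ℝ → ℂ => (f : Ω)) (funext fun x => ?_)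
      rw [eval_map_algebraMap, eval_map_algebraMap]
      exact (aeval_conj r (b x)).symm
  have hpq : algebraMap _ (RatFunc ℂ) (h.num.map (algebraMap ℝ ℂ)) =
      toComplex h * algebraMap _ (RatFunc ℂ) (h.denom.map (algebraMap ℝ ℂ)) := by
    rw [← toComplexHom_apply, ← mapCoeff_algebraMap, ← mapCoeff_algebraMap, ← map_mul]
    congr 1
    rw [← div_eq_iff (RatFunc.algebraMap_ne_zero h.denom_ne_zero), RatFunc.num_div_denom]
  have hιp : ∀ r : ℂ[X], ι (algebraMap _ _ r) = aeval ω r := by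
    intro r
    rw [← RatFunc.aeval_X_left_eq_algebraMap, ← aeval_algHom_apply, hιX]
  have hofReal : ∀ (r : ℝ[X]) (x : ℝ), (r.map (algebraMap ℝ ℂ)).eval (x : ℂ) =
      ((r.eval x : ℝ) : ℂ) :=
    fun r x => by
      rw [eval_map_algebraMap]
      exact aeval_algebraMap_apply_eq_algebraMap_eval x r
  refine conj_mem_adjoin_of_isAlgClosed ι τ (germConj_mul_self _) conjRatFunc hκ
    (fun a => ⟨starRingEnd ℂ a, rfl⟩) (mapCoeff_X _) (h := toComplex h)
    (hfg ▸ comp_mem_adjoin f g)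
    (by rw [← toComplexHom_apply, conjRatFunc_toComplexHom])
    ?_ (p := h.num.map (algebraMap ℝ ℂ)) (q := h.denom.map (algebraMap ℝ ℂ))
    ((Polynomial.map_ne_zero_iff (algebraMap ℝ ℂ).injective).mpr h.denom_ne_zero) hpq
    (hτp _) (hτp _) ?_
  · intro c hc
    have hc' : ∀ x : ℝ, ((h.num.eval x : ℝ) : ℂ) = c * ((h.denom.eval x : ℝ) : ℂ) := by
      intro x
      have h1 := hpq
      rw [hc, ← RatFunc.algebraMap_C, ← map_mul] at h1
      have h2 := congrArg (Polynomial.eval (x : ℂ)) (RatFunc.algebraMap_injective ℂ h1)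
      rwa [eval_mul, eval_C, hofReal, hofReal] at h2
    -- A constant `h` takes the value at `z` also at any other point.
    obtain ⟨y, hy⟩ : ∃ y, y ≠ z := exists_ne z
    refine hy (hz.self_of_nhds y ?_)
    have : ((h.num.eval y * h.denom.eval z : ℝ) : ℂ) = (h.num.eval z * h.denom.eval y : ℝ) := by
      push_cast
      rw [hc', hc']
      ring
    exact_mod_cast this
  · intro x hx hτx
    rw [hιX]
    induction x using Germ.inductionOn with
    | _ b =>
      have h1 : ∀ᶠ x in φ, starRingEnd ℂ (b x) = b x := Germ.coe_eq.mp hτx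
      have h2 := congrArg ι hpq
      rw [map_mul, hιp, hιp] at h2
      have h3 : aeval (b : Ω) (h.num.map (algebraMap ℝ ℂ)) *
            aeval ω (h.denom.map (algebraMap ℝ ℂ)) =
          aeval ω (h.num.map (algebraMap ℝ ℂ)) *
            aeval (b : Ω) (h.denom.map (algebraMap ℝ ℂ)) := by
        rw [hx, h2]; ring
      rw [aeval_germ, aeval_germ, aeval_germ, aeval_germ] at h3
      have h4 : ∀ᶠ x : ℝ in φ, (h.num.map (algebraMap ℝ ℂ)).eval (b x) *
          (h.denom.map (algebraMap ℝ ℂ)).eval (x : ℂ) =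
          (h.num.map (algebraMap ℝ ℂ)).eval (x : ℂ) *
          (h.denom.map (algebraMap ℝ ℂ)).eval (b x) := Germ.coe_eq.mp h3
      refine Germ.coe_eq.mpr ?_
      filter_upwards [h1, h4, hφ (nhdsWithin_le_nhds hz)] with x hx1 hx2 hx3
      -- A conjugation invariant germ has real values, to which the uniqueness on `ℝ` applies.
      obtain ⟨y, hy⟩ := Complex.conj_eq_iff_real.mp hx1
      rw [hy, hofReal, hofReal, hofReal, hofReal] at hx2
      rw [hy, hx3 y (by exact_mod_cast hx2)]

end RationalMap

theorem theorem3 (f g : RatFunc ℂ) (h : RatFunc ℝ)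
    (hf : ¬ RationalMap.IsConst f) (hg : ¬ RationalMap.IsConst g)
    (hfg : RationalMap.toComplex h = RationalMap.comp f g)
    (hinj : RationalMap.WeaklyInjective h) :
    ∃ l : RatFunc ℂ, RationalMap.IsLinearFractional l ∧
      RationalMap.IsReal (RationalMap.comp l g) := by
  exact RationalMap.exists_isReal_comp hg (RationalMap.conjRatFunc_mem_adjoin hfg hinj)
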